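/- A \emph{numbering} $\varphi$ is given by a partial-recursive function $U:\mathbb{N}\times\mathbb{N}\rightharpoonup\mathbb{N}$; its $e$-th function is $\varphi_e(x)=U(e,x)$. The set of minimal indices of $\varphi$ is $\mathrm{MIN}_\varphi=\{e\in\mathbb{N} : \varphi_j\neq\varphi_e \text{ for all } j<e\}$. The numbering $\varphi$ is \emph{computably bounded} if for every numbering $\psi$ there is a computable function $f:\mathbb{N}\to\mathbb{N}$ such that for every $e$ there is some $j\le f(e)$ with $\varphi_j=\psi_e$. A set $A\subseteq\mathbb{N}$ is \emph{$(m,k)$-recursive} if there is a computable function $f:\mathbb{N}^k\to\{0,1\}^k$ such that for every $(x_1,\dots,x_k)\in\mathbb{N}^k$ the vectors $(\chi_A(x_1),\dots,\chi_A(x_k))$ and $f(x_1,\dots,x_k)$ coincide in at least $m$ positions, where $\chi_A$ is the characteristic function of $A$. Theorem. For every computably bounded numbering $\varphi$, the set $\mathrm{MIN}_\varphi$ is not $(1,2)$-recursive. -/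

import Mathlib

/-- A numbering: a partial-recursive function `U` of two arguments; the `e`-th function of the
numbering is `x ↦ U e x`. -/
structure PRNumbering where
  U : ℕ → ℕ →. ℕ
  partrec : Partrec₂ U

namespace PRNumbering

/-- The `e`-th partial function of the numbering. -/
def fn (φ : PRNumbering) (e : ℕ) : ℕ →. ℕ := φ.U e

/-- The set of minimal indices of the numbering. -/
def MIN (φ : PRNumbering) : Set ℕ := {e | ∀ j < e, φ.fn j ≠ φ.fn e}

/-- Every numbering `ψ` translates into `φ` with a computable bound on the least translated
index; the translation itself need not be computable. -/
def ComputablyBounded (φ : PRNumbering) : Prop :=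
  ∀ ψ : PRNumbering, ∃ f : ℕ → ℕ, Computable f ∧ ∀ e, ∃ j ≤ f e, φ.fn j = ψ.fn e

end PRNumbering

/-- `A` is `(m, k)`-recursive: a computable function assigns to each `k`-tuple of numbers a
`k`-tuple of labels (`true` for "in `A`", `false` for "not in `A`") at least `m` of which are
correct. -/
def IsMKRecursive (m k : ℕ) (A : Set ℕ) : Prop :=
  ∃ f : List.Vector ℕ k → List.Vector Bool k, Computable f ∧
    ∀ x : List.Vector ℕ k, m ≤ {i : Fin k | (f x).get i = true ↔ x.get i ∈ A}.ncard

/-! The set `φ.MIN` is `Σ₂`, but its complement is not (`isSigmaTwo_mem_MIN`,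
`not_isSigmaTwo_notMem_MIN`). Labels `a`, `b`, of which one is always correct, would make the
complement `Σ₂`: `y ∉ φ.MIN` would be equivalent to the existence of a certificate built from labels
and one minimal index (`not_labels`). If some nonminimal `y` had no certificate, the labels of pairs
beyond some bound would form a tournament among candidates, whose winner in a block containing a
minimal index is itself minimal (`likeliest_mem`). That computes arbitrarily large minimal indices,
which the recursion theorem forbids (`not_exists_computable_pair`). -/

/-- A predicate is `Σ₂` if it has the form `∃ x, ∀ s, Q (a, x, s)` with `Q` computable. -/
def IsSigmaTwo {α : Type*} [Primcodable α] (p : α → Prop) : Prop :=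
  ∃ Q : α × ℕ × ℕ → Bool, Computable Q ∧ ∀ a, p a ↔ ∃ x, ∀ s, Q (a, x, s) = true

/-! ### Closure properties of `Σ₂` predicates. -/

namespace IsSigmaTwo

variable {α β : Type*} [Primcodable α] [Primcodable β] {p q : α → Prop}

theorem of_iff (hp : IsSigmaTwo p) (h : ∀ a, q a ↔ p a) : IsSigmaTwo q := by
  obtain ⟨Q, hQ, hpQ⟩ := hp
  exact ⟨Q, hQ, fun a => (h a).trans (hpQ a)⟩

theorem of_computable {f : α → Bool} (hf : Computable f) : IsSigmaTwo (fun a => f a = true) :=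
  ⟨fun a => f a.1, hf.comp .fst, fun a => by simp⟩

theorem comp (hp : IsSigmaTwo p) {g : β → α} (hg : Computable g) :
    IsSigmaTwo (fun b => p (g b)) := by
  obtain ⟨Q, hQ, hpQ⟩ := hp
  exact ⟨fun b => Q (g b.1, b.2), hQ.comp ((hg.comp .fst).pair .snd), fun b => hpQ (g b)⟩

theorem exists_nat {p : α × ℕ → Prop} (hp : IsSigmaTwo p) :
    IsSigmaTwo (fun a => ∃ n, p (a, n)) := by
  obtain ⟨Q, hQ, hpQ⟩ := hp
  have hu : Computable fun b : α × ℕ × ℕ => b.2.1.unpair := Computable.unpair.comp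
    (Computable.fst.comp .snd)
  refine ⟨fun b => Q ((b.1, b.2.1.unpair.1), b.2.1.unpair.2, b.2.2),
    hQ.comp ((Computable.fst.pair (Computable.fst.comp hu)).pair
      ((Computable.snd.comp hu).pair (Computable.snd.comp .snd))), fun a => ⟨?_, ?_⟩⟩
  · rintro ⟨n, hn⟩
    obtain ⟨x, hx⟩ := (hpQ _).1 hn
    exact ⟨Nat.pair n x, by simpa using hx⟩
  · rintro ⟨x, hx⟩
    exact ⟨x.unpair.1, (hpQ _).2 ⟨x.unpair.2, hx⟩⟩

theorem and (hp : IsSigmaTwo p) (hq : IsSigmaTwo q) : IsSigmaTwo (fun a => p a ∧ q a) := by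
  obtain ⟨Q, hQ, hpQ⟩ := hp
  obtain ⟨R, hR, hqR⟩ := hq
  have hu : Computable fun b : α × ℕ × ℕ => b.2.1.unpair := Computable.unpair.comp
    (Computable.fst.comp .snd)
  refine ⟨fun b => Q (b.1, b.2.1.unpair.1, b.2.2) && R (b.1, b.2.1.unpair.2, b.2.2),
    Primrec.and.to_comp.comp
      (hQ.comp (Computable.fst.pair ((Computable.fst.comp hu).pair (Computable.snd.comp .snd))))
      (hR.comp (Computable.fst.pair ((Computable.snd.comp hu).pair (Computable.snd.comp .snd)))),
    fun a => ⟨?_, ?_⟩⟩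
  · rintro ⟨h1, h2⟩
    obtain ⟨x, hx⟩ := (hpQ _).1 h1
    obtain ⟨y, hy⟩ := (hqR _).1 h2
    exact ⟨Nat.pair x y, by simp [hx, hy]⟩
  · rintro ⟨x, hx⟩
    simp only [Bool.and_eq_true] at hx
    exact ⟨(hpQ _).2 ⟨_, fun s => (hx s).1⟩, (hqR _).2 ⟨_, fun s => (hx s).2⟩⟩

theorem or (hp : IsSigmaTwo p) (hq : IsSigmaTwo q) : IsSigmaTwo (fun a => p a ∨ q a) := by
  obtain ⟨Q, hQ, hpQ⟩ := hp
  obtain ⟨R, hR, hqR⟩ := hq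
  have hu : Computable fun b : α × ℕ × ℕ => b.2.1.div2 := Computable.nat_div2.comp
    (Computable.fst.comp .snd)
  refine ⟨fun b => bif b.2.1.bodd then Q (b.1, b.2.1.div2, b.2.2) else R (b.1, b.2.1.div2, b.2.2),
    Computable.cond (Computable.nat_bodd.comp (Computable.fst.comp .snd))
      (hQ.comp (Computable.fst.pair (hu.pair (Computable.snd.comp .snd))))
      (hR.comp (Computable.fst.pair (hu.pair (Computable.snd.comp .snd)))),
    fun a => ⟨?_, ?_⟩⟩
  · rintro (h | h)
    · obtain ⟨x, hx⟩ := (hpQ _).1 h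
      exact ⟨Nat.bit true x, by simpa [Nat.bodd_bit, Nat.div2_bit] using hx⟩
    · obtain ⟨x, hx⟩ := (hqR _).1 h
      exact ⟨Nat.bit false x, by simpa [Nat.bodd_bit, Nat.div2_bit] using hx⟩
  · rintro ⟨x, hx⟩
    cases hb : x.bodd
    · exact .inr ((hqR _).2 ⟨x.div2, by simpa [hb] using hx⟩)
    · exact .inl ((hpQ _).2 ⟨x.div2, by simpa [hb] using hx⟩)

/-- The witnesses for all `j < F a` are collected in one coded list, and the universal variable
codes both `j` and the stage. -/
theorem forall_lt {p : α × ℕ → Prop} (hp : IsSigmaTwo p) {F : α → ℕ} (hF : Computable F) :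
    IsSigmaTwo (fun a => ∀ j < F a, p (a, j)) := by
  obtain ⟨Q, hQ, hpQ⟩ := hp
  have hs : Computable fun b : α × ℕ × ℕ => b.2.2.unpair := Computable.unpair.comp
    (Computable.snd.comp .snd)
  have hl : Computable fun b : α × ℕ × ℕ =>
      (Denumerable.ofNat (List ℕ) b.2.1).getD b.2.2.unpair.1 0 :=
    (Primrec.list_getD 0).to_comp.comp
      ((Primrec.ofNat (List ℕ)).to_comp.comp (Computable.fst.comp .snd)) (Computable.fst.comp hs)
  refine ⟨fun b => bif decide (b.2.2.unpair.1 < F b.1) then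
      Q ((b.1, b.2.2.unpair.1), (Denumerable.ofNat (List ℕ) b.2.1).getD b.2.2.unpair.1 0,
        b.2.2.unpair.2) else true,
    Computable.cond
      (Primrec.nat_lt.decide.to_comp.comp (Computable.fst.comp hs) (hF.comp .fst))
      (hQ.comp ((Computable.fst.pair (Computable.fst.comp hs)).pair
        (hl.pair (Computable.snd.comp hs)))) (.const true), fun a => ⟨?_, ?_⟩⟩
  · intro h
    have h' : ∀ j, ∃ x, j < F a → ∀ s, Q ((a, j), x, s) = true := fun j => by
      by_cases hj : j < F a
      · obtain ⟨x, hx⟩ := (hpQ _).1 (h j hj)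
        exact ⟨x, fun _ => hx⟩
      · exact ⟨0, fun h => absurd h hj⟩
    choose w hw using h'
    refine ⟨Encodable.encode ((List.range (F a)).map w), fun s => ?_⟩
    by_cases hj : s.unpair.1 < F a
    · simpa [hj] using hw _ hj _
    · simp [hj]
  · rintro ⟨x, hx⟩ j hj
    refine (hpQ _).2 ⟨(Denumerable.ofNat (List ℕ) x).getD j 0, fun s => ?_⟩
    simpa [hj] using hx (Nat.pair j s)

open Nat.Partrec Nat.Partrec.Code

theorem exists_mem_eval_notMem_eval :
    IsSigmaTwo (fun c : Code × Code => ∃ n v, v ∈ eval c.1 n ∧ v ∉ eval c.2 n) := by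
  have key : IsSigmaTwo (fun a : ((Code × Code) × ℕ) × ℕ =>
      a.2 ∈ eval a.1.1.1 a.1.2 ∧ a.2 ∉ eval a.1.1.2 a.1.2) := by
    have ev : Primrec fun b : (Code × ℕ × ℕ) × ℕ =>
        decide (evaln b.2 b.1.1 b.1.2.1 = some b.1.2.2) :=
      Primrec.eq.decide.comp
        (primrec_evaln.comp ((Primrec.snd.pair (Primrec.fst.comp .fst)).pair
          (Primrec.fst.comp (Primrec.snd.comp .fst))))
        (Primrec.option_some.comp (Primrec.snd.comp (Primrec.snd.comp .fst)))
    have mem (i : Code × Code → Code) (hi : Primrec i) :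
        Primrec fun a : ((Code × Code) × ℕ) × ℕ => (i a.1.1, a.1.2, a.2) :=
      (hi.comp (Primrec.fst.comp .fst)).pair ((Primrec.snd.comp .fst).pair .snd)
    have h1 : IsSigmaTwo (fun b : Code × ℕ × ℕ => b.2.2 ∈ eval b.1 b.2.1) :=
      ⟨fun b => decide (evaln b.2.1 b.1.1 b.1.2.1 = some b.1.2.2),
        (ev.comp (Primrec.fst.pair (Primrec.fst.comp .snd))).to_comp,
        fun b => by simp [evaln_complete]⟩
    have h2 : IsSigmaTwo (fun b : Code × ℕ × ℕ => b.2.2 ∉ eval b.1 b.2.1) :=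
      ⟨fun b => !decide (evaln b.2.2 b.1.1 b.1.2.1 = some b.1.2.2),
        (Primrec.not.comp (ev.comp (Primrec.fst.pair (Primrec.snd.comp .snd)))).to_comp,
        fun b => by simp [evaln_complete]⟩
    exact (h1.comp (mem _ .fst).to_comp).and (h2.comp (mem _ .snd).to_comp)
  exact key.exists_nat.exists_nat

theorem eval_ne_eval : IsSigmaTwo (fun c : Code × Code => eval c.1 ≠ eval c.2) := by
  refine (exists_mem_eval_notMem_eval.or
    (exists_mem_eval_notMem_eval.comp (Computable.snd.pair .fst))).of_iff fun c => ?_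
  rw [← not_iff_not]
  push Not
  constructor
  · intro h
    rw [h]
    exact ⟨fun _ _ h => h, fun _ _ h => h⟩
  · rintro ⟨h1, h2⟩
    exact funext fun n => Part.ext fun v => ⟨h1 n v, h2 n v⟩

end IsSigmaTwo

-- Diagonalization: a program that knows its own code `c` halts on `n`, with value 0, exactly when
-- some stage refutes the witness `n` for `c`.
open Nat.Partrec Nat.Partrec.Code in
theorem not_isSigmaTwo_eval_eq_zero :
    ¬ IsSigmaTwo (fun c : Code => eval c = fun _ => Part.some 0) := by
  rintro ⟨Q, hQ, h⟩
  have hF : Partrec₂ fun (c : Code) (n : ℕ) =>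
      (Nat.rfind fun s => Part.some (!Q (c, n, s))).map fun _ => 0 := by
    refine Partrec.map (Partrec.rfind ?_) (Computable.const 0).to₂
    refine Computable.partrec (Primrec.not.to_comp.comp (hQ.comp ?_))
    exact (Computable.fst.comp .fst).pair ((Computable.snd.comp .fst).pair .snd)
  obtain ⟨c, hc⟩ := fixed_point₂ hF
  have key : (eval c = fun _ => Part.some 0) ↔ ∀ n, ∃ s, Q (c, n, s) = false := by
    rw [hc]
    refine funext_iff.trans (forall_congr' fun n => ?_)
    rw [Part.eq_some_iff]
    simp only [Part.mem_map_iff, and_true]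
    refine Part.dom_iff_mem.symm.trans (Nat.rfind_dom'.trans ?_)
    simp
  have h2 := h c
  by_cases hz : eval c = fun _ => Part.some 0
  · obtain ⟨x, hx⟩ := h2.1 hz
    obtain ⟨s, hs⟩ := key.1 hz x
    simp [hx s] at hs
  · refine hz (key.2 fun n => ?_)
    by_contra hn
    exact hz (h2.2 ⟨n, fun s => by simpa using not_exists.1 hn s⟩)

/-! ### Computably bounded numberings and their minimal indices. -/

namespace PRNumbering

open Nat.Partrec Nat.Partrec.Code

variable {φ : PRNumbering}

theorem exists_code_fn (φ : PRNumbering) :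
    ∃ K : ℕ → Code, Computable K ∧ ∀ j, eval (K j) = φ.fn j := by
  obtain ⟨c, hc⟩ := exists_code.1 (Partrec₂.unpaired'.2 φ.partrec)
  refine ⟨fun j => curry c j, (primrec₂_curry.comp (.const c) .id).to_comp, fun j => ?_⟩
  funext x
  rw [eval_curry, hc]
  simp [Nat.unpaired, fn]

theorem ComputablyBounded.exists_bound (hφ : φ.ComputablyBounded) :
    ∃ F : Code → ℕ, Computable F ∧ ∀ c, ∃ j ≤ F c, φ.fn j = eval c := by
  obtain ⟨f, hf, h⟩ := hφ ⟨fun e => eval (Denumerable.ofNat Code e),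
    eval_part.comp ((Computable.ofNat Code).comp .fst) .snd⟩
  refine ⟨fun c => f (Encodable.encode c), hf.comp .encode, fun c => ?_⟩
  obtain ⟨j, hj, hjc⟩ := h (Encodable.encode c)
  exact ⟨j, hj, by simpa [fn] using hjc⟩

theorem exists_mem_MIN_le (j : ℕ) : ∃ i ≤ j, i ∈ φ.MIN ∧ φ.fn i = φ.fn j := by
  classical
  have h : ∃ i, φ.fn i = φ.fn j := ⟨j, rfl⟩
  refine ⟨Nat.find h, Nat.find_min' h rfl, fun k hk hkj => ?_, Nat.find_spec h⟩
  exact Nat.find_min h hk (hkj.trans (Nat.find_spec h))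

theorem eq_of_mem_MIN {i j : ℕ} (hi : i ∈ φ.MIN) (hj : j ∈ φ.MIN) (h : φ.fn i = φ.fn j) :
    i = j := by
  rcases lt_trichotomy i j with hij | hij | hij
  · exact absurd h (hj i hij)
  · exact hij
  · exact absurd h.symm (hi j hij)

/-- Pairs of large indices, one of which is minimal, cannot be computed: by the recursion theorem
both functions of the pair would also have small indices. -/
theorem ComputablyBounded.not_exists_computable_pair (hφ : φ.ComputablyBounded)
    {h : ℕ → ℕ × ℕ} (hh : Computable h) (hlt : ∀ n, n < (h n).1 ∧ n < (h n).2) :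
    ∃ n, (h n).1 ∉ φ.MIN ∧ (h n).2 ∉ φ.MIN := by
  obtain ⟨F, hF, hFb⟩ := hφ.exists_bound
  -- The sum bounds the indices of both functions that `c` will compute, so both entries of `h` at
  -- this argument exceed them.
  have hN : Computable fun c : Code => F (curry c 0) + F (curry c 1) :=
    Primrec.nat_add.to_comp.comp (hF.comp (primrec₂_curry.comp .id (.const 0)).to_comp)
      (hF.comp (primrec₂_curry.comp .id (.const 1)).to_comp)
  have hG : Partrec₂ fun (c : Code) (x : ℕ) =>
      φ.U (bif x.unpair.1 == 0 then (h (F (curry c 0) + F (curry c 1))).1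
        else (h (F (curry c 0) + F (curry c 1))).2) x.unpair.2 := by
    have hu : Computable fun p : Code × ℕ => p.2.unpair := Computable.unpair.comp .snd
    have hv := hh.comp (hN.comp (Computable.fst (α := Code) (β := ℕ)))
    exact φ.partrec.comp (Computable.cond
      (Primrec.beq.to_comp.comp (Computable.fst.comp hu) (.const 0))
      (Computable.fst.comp hv) (Computable.snd.comp hv)) (Computable.snd.comp hu)
  obtain ⟨c, hc⟩ := fixed_point₂ hG
  refine ⟨F (curry c 0) + F (curry c 1), ?_, ?_⟩
  · obtain ⟨j, hj, hjc⟩ := hFb (curry c 0)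
    refine fun hm => hm j (by have := (hlt (F (curry c 0) + F (curry c 1))).1; omega) ?_
    rw [hjc]
    funext x
    rw [eval_curry, hc]
    simp [fn]
  · obtain ⟨j, hj, hjc⟩ := hFb (curry c 1)
    refine fun hm => hm j (by have := (hlt (F (curry c 0) + F (curry c 1))).2; omega) ?_
    rw [hjc]
    funext x
    rw [eval_curry, hc]
    simp [fn]

/-- A computable relation which forces one of its two arguments to be a minimal index does not
hold for arbitrarily large arguments. -/
theorem ComputablyBounded.exists_forall_lt_of_mem_MIN (hφ : φ.ComputablyBounded)
    {Q : ℕ → ℕ → Bool} (hQ : Computable₂ Q)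
    (hQm : ∀ u v, Q u v = true → u ∈ φ.MIN ∨ v ∈ φ.MIN) :
    ∃ n, ∀ u v, n < u → n < v → Q u v = false := by
  by_contra! hne
  have hP : Computable₂ fun n k : ℕ => Q (n + 1 + k.unpair.1) (n + 1 + k.unpair.2) := by
    have hu : Computable fun p : ℕ × ℕ => p.2.unpair := Computable.unpair.comp .snd
    have hn : Computable fun p : ℕ × ℕ => p.1 + 1 := Computable.succ.comp .fst
    exact hQ.comp (Primrec.nat_add.to_comp.comp hn (Computable.fst.comp hu))
      (Primrec.nat_add.to_comp.comp hn (Computable.snd.comp hu))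
  have hex : ∀ n, ∃ k : ℕ, Q (n + 1 + k.unpair.1) (n + 1 + k.unpair.2) = true := fun n => by
    obtain ⟨u, v, hu, hv, h⟩ := hne n
    obtain ⟨u, rfl⟩ := Nat.exists_eq_add_of_lt hu
    obtain ⟨v, rfl⟩ := Nat.exists_eq_add_of_lt hv
    refine ⟨Nat.pair u v, ?_⟩
    simpa [Nat.add_right_comm] using h
  have hk : Computable fun n => Nat.find (hex n) := by
    refine (Partrec.rfind hP.partrec₂).of_eq_tot fun n => ?_
    rw [Nat.mem_rfind]
    refine ⟨by simpa using (Nat.find_spec (hex n)).symm, fun hm => ?_⟩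
    simpa using (Bool.eq_false_of_not_eq_true (Nat.find_min (hex n) hm)).symm
  have hku : Computable fun n => (Nat.find (hex n)).unpair := Computable.unpair.comp hk
  obtain ⟨n, h1, h2⟩ := hφ.not_exists_computable_pair
    (h := fun n => (n + 1 + (Nat.find (hex n)).unpair.1, n + 1 + (Nat.find (hex n)).unpair.2))
    ((Primrec.nat_add.to_comp.comp .succ (Computable.fst.comp hku)).pair
      (Primrec.nat_add.to_comp.comp .succ (Computable.snd.comp hku)))
    (fun n => by constructor <;> simp only <;> omega)
  exact (hQm _ _ (Nat.find_spec (hex n))).elim h1 h2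

/-- Minimal indices exist in blocks with computable bounds, as the constant functions have
computably bounded indices. -/
theorem ComputablyBounded.exists_block (hφ : φ.ComputablyBounded) :
    ∃ B : ℕ → ℕ, Computable B ∧ ∀ n, ∃ z ∈ φ.MIN, n < z ∧ z ≤ B n := by
  obtain ⟨F, hF, hFb⟩ := hφ.exists_bound
  have hFc : Computable fun n => F (Code.const n) := hF.comp primrec_const.to_comp
  -- Summing the bounds gives one that dominates each of them. The `n + 2` constant functions cannot
  -- all have their minimal indices among `0, …, n`.
  let S : ℕ → ℕ := fun n => Nat.rec 0 (fun k s => s + F (Code.const k)) n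
  have hS : Computable S := Computable.nat_rec .id (.const 0)
    (Primrec.nat_add.to_comp.comp (Computable.snd.comp .snd)
      (hFc.comp (Computable.fst.comp .snd))).to₂
  have hle : ∀ n, ∀ k < n, F (Code.const k) ≤ S n := fun n => by
    induction n with
    | zero => simp
    | succ n ih =>
      intro k hk
      have : S (n + 1) = S n + F (Code.const n) := rfl
      rcases Nat.lt_succ_iff_lt_or_eq.1 hk with h | rfl
      · exact (ih k h).trans (by omega)
      · omega
  refine ⟨fun n => S (n + 2), hS.comp (Computable.succ.comp .succ), fun n => ?_⟩
  have hex : ∀ k, ∃ i ≤ F (Code.const k), i ∈ φ.MIN ∧ φ.fn i = eval (Code.const k) := fun k => by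
    obtain ⟨j, hj, hjc⟩ := hFb (Code.const k)
    obtain ⟨i, hi, him, hij⟩ := exists_mem_MIN_le (φ := φ) j
    exact ⟨i, hi.trans hj, him, hij.trans hjc⟩
  choose i hi him hic using hex
  by_contra! hne
  have hmaps : ∀ k ∈ Finset.range (n + 2), i k ∈ Finset.range (n + 1) := fun k hk => by
    rw [Finset.mem_range] at hk ⊢
    by_contra hlt
    exact absurd ((hi k).trans (hle _ k hk)) (not_le.2 (hne _ (him k) (by omega)))
  obtain ⟨k, -, l, -, hkl, h⟩ := Finset.exists_ne_map_eq_of_card_lt_of_maps_to (by simp) hmaps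
  have := (hic k).symm.trans ((congrArg φ.fn h).trans (hic l))
  exact hkl (by simpa using congrFun this 0)

theorem isSigmaTwo_mem_MIN (φ : PRNumbering) : IsSigmaTwo (fun j => j ∈ φ.MIN) := by
  obtain ⟨K, hK, hKe⟩ := φ.exists_code_fn
  have h : IsSigmaTwo (fun p : ℕ × ℕ => eval (K p.2) ≠ eval (K p.1)) :=
    IsSigmaTwo.eval_ne_eval.comp ((hK.comp .snd).pair (hK.comp .fst))
  exact (h.forall_lt .id).of_iff fun j => by simp [MIN, hKe]

/-- With `i` the minimal index of the zero function, a code computes zero iff each `k ≤ F c` other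
than `i` is nonminimal or indexes another function. This would be `Σ₂` if nonminimality were. -/
theorem ComputablyBounded.not_isSigmaTwo_notMem_MIN (hφ : φ.ComputablyBounded) :
    ¬ IsSigmaTwo (fun j => j ∉ φ.MIN) := by
  intro hM
  obtain ⟨K, hK, hKe⟩ := φ.exists_code_fn
  obtain ⟨F, hF, hFb⟩ := hφ.exists_bound
  obtain ⟨j, -, hj⟩ := hFb Code.zero
  obtain ⟨i, -, him, hij⟩ := exists_mem_MIN_le (φ := φ) j
  have hi : φ.fn i = fun _ => Part.some 0 := hij.trans (hj.trans (by funext x; rfl))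
  have h1 : IsSigmaTwo (fun p : Code × ℕ => (p.2 == i) = true) :=
    .of_computable (Primrec.beq.to_comp.comp .snd (.const i))
  have h2 : IsSigmaTwo (fun p : Code × ℕ => eval (K p.2) ≠ eval p.1) :=
    IsSigmaTwo.eval_ne_eval.comp ((hK.comp .snd).pair .fst)
  refine not_isSigmaTwo_eval_eq_zero ((((h1.or (hM.comp .snd)).or h2).forall_lt
    (Computable.succ.comp hF)).of_iff fun c => ?_)
  simp only [beq_iff_eq, hKe]
  constructor
  · intro hc k _
    by_contra! hk
    exact hk.1.1 (eq_of_mem_MIN hk.1.2 him (hk.2.trans (hc.trans hi.symm)))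
  · intro h
    obtain ⟨k, hk, hkc⟩ := hFb c
    obtain ⟨l, hl, hlm, hlk⟩ := exists_mem_MIN_le (φ := φ) k
    rcases h l (Nat.lt_succ_of_le (hl.trans hk)) with (rfl | h) | h
    · exact (hlk.trans hkc).symm.trans hi
    · exact absurd hlm h
    · exact absurd (hlk.trans hkc) h

/-! ### The tournament between candidates. -/

/-- The number among `n + 1, …, n + 1 + k` that is the most likely to be minimal, where `b y z`
selects the candidates `z` and the labels `a t z`, `b t z` decide between candidates. -/
def likeliest (a b : ℕ → ℕ → Bool) (y n : ℕ) : ℕ → ℕ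
  | 0 => n + 1
  | k + 1 => bif b y (n + 2 + k) && (!b y (likeliest a b y n k) ||
      (b (likeliest a b y n k) (n + 2 + k) && !a (likeliest a b y n k) (n + 2 + k)))
      then n + 2 + k else likeliest a b y n k

theorem lt_likeliest (a b : ℕ → ℕ → Bool) (y n k : ℕ) : n < likeliest a b y n k := by
  induction k with
  | zero => simp [likeliest]
  | succ k ih =>
    rw [likeliest, Bool.cond_eq_ite]
    split_ifs
    · omega
    · exact ih

theorem computable_likeliest {a b : ℕ → ℕ → Bool} (ha : Computable₂ a) (hb : Computable₂ b)
    (y : ℕ) : Computable₂ (likeliest a b y) := by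
  have hz : Computable fun p : (ℕ × ℕ) × ℕ × ℕ => p.1.1 + 2 + p.2.1 :=
    Primrec.nat_add.to_comp.comp (Computable.succ.comp (Computable.succ.comp
      (Computable.fst.comp .fst))) (Computable.fst.comp .snd)
  have ht : Computable fun p : (ℕ × ℕ) × ℕ × ℕ => p.2.2 := Computable.snd.comp .snd
  refine Computable.of_eq (Computable.nat_rec (α := ℕ × ℕ) (f := fun p => p.2)
    (g := fun p => p.1 + 1) (h := fun p q => bif b y (p.1 + 2 + q.1) && (!b y q.2 ||
      (b q.2 (p.1 + 2 + q.1) && !a q.2 (p.1 + 2 + q.1))) then p.1 + 2 + q.1 else q.2)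
    .snd (Computable.succ.comp .fst) ?_) ?_
  · exact Computable.cond (Primrec.and.to_comp.comp (hb.comp (.const y) hz)
      (Primrec.or.to_comp.comp (Primrec.not.to_comp.comp (hb.comp (.const y) ht))
        (Primrec.and.to_comp.comp (hb.comp ht hz) (Primrec.not.to_comp.comp (ha.comp ht hz)))))
      hz ht
  · rintro ⟨n, k⟩
    induction k with
    | zero => rfl
    | succ k ih => simp only [likeliest, ← ih]

/-- If one of two candidates is in `A` and their labels differ, the one labelled `true` is in `A`:
otherwise both labels would be wrong. So the winner stays in `A` once a member has entered. -/
theorem likeliest_mem {a b : ℕ → ℕ → Bool} {A : Set ℕ} {y n k : ℕ}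
    (hA : ∀ z, n < z → z ∈ A → b y z = true)
    (hab : ∀ u v, n < u → n < v → b y u = true → b y v = true → a u v ≠ b u v)
    (hlab : ∀ u v, (a u v = true ↔ u ∈ A) ∨ (b u v = true ↔ v ∈ A))
    {z : ℕ} (hz : z ∈ A) (hnz : n < z) (hzk : z ≤ n + 1 + k) : likeliest a b y n k ∈ A := by
  induction k generalizing z with
  | zero =>
    obtain rfl : z = n + 1 := by omega
    exact hz
  | succ k ih =>
    have hlt := lt_likeliest a b y n k
    rw [likeliest]
    have hw : n < n + 2 + k := by omega
    have hor : n + 2 + k ∈ A ∨ likeliest a b y n k ∈ A := by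
      by_cases h : z = n + 2 + k
      · exact .inl (h ▸ hz)
      · exact .inr (ih hz hnz (by omega))
    clear ih hz hnz hzk
    generalize likeliest a b y n k = t at *
    generalize n + 2 + k = w at *
    have hAt := hA t hlt
    have hAw := hA w hw
    have hne := hab t w hlt hw
    have hl := hlab t w
    clear hA hab hlab
    cases h1 : b y w <;> cases h2 : b y t <;> cases h3 : a t w <;> cases h4 : b t w <;> simp_all <;>
      tauto

theorem ComputablyBounded.not_labels (hφ : φ.ComputablyBounded) {a b : ℕ → ℕ → Bool}
    (ha : Computable₂ a) (hb : Computable₂ b)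
    (hlab : ∀ u v, (a u v = true ↔ u ∈ φ.MIN) ∨ (b u v = true ↔ v ∈ φ.MIN)) : False := by
  obtain ⟨B, hB, hBm⟩ := hφ.exists_block
  obtain ⟨m, hm⟩ := hφ.exists_forall_lt_of_mem_MIN (Q := fun u v => a u v && b u v)
    (Primrec.and.to_comp.comp ha hb) fun u v h => by
      rw [Bool.and_eq_true] at h
      exact (hlab u v).imp (·.1 h.1) (·.1 h.2)
  -- In the first certificate the label of `z` is wrong, so that of `y` is right. In the second, a
  -- minimal `y` would force `z` and `z'` to be minimal, making both labels of `(z, z')` wrong.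
  have key : ∀ y, y ∉ φ.MIN ↔
      (∃ z, z ∈ φ.MIN ∧ (!a y z && !b y z) = true) ∨
      ∃ z z', (!a y z && b y z && (!a y z' && b y z') && (!a z z' && !b z z')) = true := by
    intro y
    simp only [Bool.and_eq_true, Bool.not_eq_true']
    constructor
    · intro hy
      by_contra! hcert
      obtain ⟨hc1, hc2⟩ := hcert
      -- As `y` is not minimal, two `true` labels on `(y, u)` force `u` to be minimal, so this
      -- happens only for bounded `u`.
      obtain ⟨l, hl⟩ := hφ.exists_forall_lt_of_mem_MIN (Q := fun u _ => a y u && b y u)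
        (Primrec.and.to_comp.comp (ha.comp (.const y) .fst) (hb.comp (.const y) .fst))
        fun u v h => by
          rw [Bool.and_eq_true] at h
          exact .inl (((hlab y u).resolve_left fun h' => hy (h'.1 h.1)).1 h.2)
      have hA : ∀ z, z ∈ φ.MIN → b y z = true := fun z hz => by
        have := hc1 z hz
        have := hlab y z
        cases h1 : a y z <;> cases h2 : b y z <;> simp_all
      have hg : Computable fun n => likeliest a b y (n + (m + l)) (B (n + (m + l))) := by
        have hn : Computable fun n => n + (m + l) :=
          Primrec.nat_add.to_comp.comp .id (.const (m + l))
        exact (computable_likeliest ha hb y).comp hn (hB.comp hn)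
      obtain ⟨n, h1, -⟩ := hφ.not_exists_computable_pair (hg.pair hg) fun n => by
        have := lt_likeliest a b y (n + (m + l)) (B (n + (m + l)))
        constructor <;> simp only <;> omega
      obtain ⟨z, hz, hnz, hzB⟩ := hBm (n + (m + l))
      -- Beyond `m` and `l`, candidates `u`, `v` are not both labelled `true`; the missing second
      -- certificate excludes both `false`.
      refine h1 (likeliest_mem (fun z _ => hA z) ?_ hlab hz hnz (by omega))
      intro u v hu hv hbu hbv
      have e1 := hm u v (by omega) (by omega)
      have e2 := hl u u (by omega) (by omega)
      have e3 := hl v v (by omega) (by omega)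
      have e4 := hc2 u v
      cases h3 : a u v <;> cases h4 : b u v <;> simp_all
    · rintro (⟨z, hz, h1, h2⟩ | ⟨z, z', ⟨⟨h1, h2⟩, h3, h4⟩, h5, h6⟩) hy
      · have := hlab y z
        simp_all
      · have e1 := hlab y z
        have e2 := hlab y z'
        have e3 := hlab z z'
        simp_all
  refine hφ.not_isSigmaTwo_notMem_MIN (IsSigmaTwo.of_iff (.or ?_ ?_) key)
  · refine IsSigmaTwo.exists_nat
      (p := fun q : ℕ × ℕ => q.2 ∈ φ.MIN ∧ (!a q.1 q.2 && !b q.1 q.2) = true)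
      ((φ.isSigmaTwo_mem_MIN.comp .snd).and (.of_computable ?_))
    exact Primrec.and.to_comp.comp (Primrec.not.to_comp.comp ha) (Primrec.not.to_comp.comp hb)
  · refine IsSigmaTwo.exists_nat (p := fun q : ℕ × ℕ => ∃ z', _) (IsSigmaTwo.exists_nat
      (p := fun q : (ℕ × ℕ) × ℕ => (!a q.1.1 q.1.2 && b q.1.1 q.1.2 &&
        (!a q.1.1 q.2 && b q.1.1 q.2) && (!a q.1.2 q.2 && !b q.1.2 q.2)) = true)
      (.of_computable ?_))
    have hy : Computable fun q : (ℕ × ℕ) × ℕ => q.1.1 := Computable.fst.comp .fst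
    have hz : Computable fun q : (ℕ × ℕ) × ℕ => q.1.2 := Computable.snd.comp .fst
    have hz' : Computable fun q : (ℕ × ℕ) × ℕ => q.2 := Computable.snd
    have hand : Computable₂ and := Primrec.and.to_comp
    have hnot : Computable not := Primrec.not.to_comp
    exact hand.comp (hand.comp (hand.comp (hnot.comp (ha.comp hy hz)) (hb.comp hy hz))
      (hand.comp (hnot.comp (ha.comp hy hz')) (hb.comp hy hz')))
      (hand.comp (hnot.comp (ha.comp hz hz')) (hnot.comp (hb.comp hz hz')))

end PRNumbering

theorem IsMKRecursive.exists_labels {A : Set ℕ} (h : IsMKRecursive 1 2 A) :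
    ∃ a b : ℕ → ℕ → Bool, Computable₂ a ∧ Computable₂ b ∧
      ∀ u v, (a u v = true ↔ u ∈ A) ∨ (b u v = true ↔ v ∈ A) := by
  obtain ⟨f, hf, h⟩ := h
  have hv : Computable fun p : ℕ × ℕ => f (p.1 ::ᵥ p.2 ::ᵥ .nil) :=
    hf.comp (Computable.vector_cons.comp .fst (Computable.vector_cons.comp .snd (.const _)))
  refine ⟨fun u v => (f (u ::ᵥ v ::ᵥ .nil)).get 0, fun u v => (f (u ::ᵥ v ::ᵥ .nil)).get 1,
    Computable.vector_get.comp hv (.const 0), Computable.vector_get.comp hv (.const 1),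
    fun u v => ?_⟩
  obtain ⟨i, hi⟩ := Set.nonempty_of_ncard_ne_zero (Nat.one_le_iff_ne_zero.1
    (h (u ::ᵥ v ::ᵥ .nil)))
  fin_cases i
  · exact .inl hi
  · exact .inr hi

theorem mainTheorem7 (φ : PRNumbering) (hφ : φ.ComputablyBounded) :
    ¬ IsMKRecursive 1 2 φ.MIN := by
  intro h
  obtain ⟨a, b, ha, hb, hlab⟩ := h.exists_labels
  exact hφ.not_labels ha hb hlab
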